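/- Let $\mathbb{F}_2^n$ have standard basis $e_1,\dots,e_n$ and write $x=(x_1,\dots,x_n)$ for its elements. For a non-empty set $A\subseteq\mathbb{F}_2^n$ put $A+A=\{a+b: a,b\in A\}$ and $\sigma[A]=|A+A|/|A|$. Call $A$ a shift-minimal downset (SMD) if (a) whenever $1\le i\le n$, $x_i=0$ and $x+e_i\in A$, then $x\in A$; and (b) whenever $1\le i<j\le n$, $x_i=x_j=0$ and $x+e_j\in A$, then $x+e_i\in A$. For $0\le m\le n$ regard $\mathbb{F}_2^m$ as the subspace $\{x\in\mathbb{F}_2^n: x_i=0 \text{ for all } i>m\}$ of $\mathbb{F}_2^n$. Theorem. There is an absolute constant $C>0$ such that for every integer $n\ge 0$ and every non-empty SMD $A\subseteq\mathbb{F}_2^n$, the set $A$ is contained in a union of at most $C\,\sigma[A]^{30}$ translates of $\mathbb{F}_2^{\lfloor\log_2|A|\rfloor}$. -/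

import Mathlib

open Finset Pointwise

/-- `A ⊆ 𝔽₂^ι` is a downset: whenever `x ⊥ e_i` (that is, `x i = 0`) and `x + e_i ∈ A`,
also `x ∈ A`. Here `e_i = Pi.single i 1`. -/
def IsDownset {ι : Type*} [DecidableEq ι] (A : Finset (ι → ZMod 2)) : Prop :=
  ∀ (i : ι) (x : ι → ZMod 2), x i = 0 → x + Pi.single i 1 ∈ A → x ∈ A

/-- `A ⊆ 𝔽₂^ι` is shift-minimal: whenever `i < j`, `x ⊥ e_i`, `x ⊥ e_j` and `x + e_j ∈ A`,
also `x + e_i ∈ A`. -/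
def IsShiftMinimal {ι : Type*} [LinearOrder ι] (A : Finset (ι → ZMod 2)) : Prop :=
  ∀ (i j : ι) (x : ι → ZMod 2), i < j → x i = 0 → x j = 0 →
    x + Pi.single j 1 ∈ A → x + Pi.single i 1 ∈ A

/-- A shift-minimal downset (SMD). -/
def IsSMD {ι : Type*} [LinearOrder ι] (A : Finset (ι → ZMod 2)) : Prop :=
  IsDownset A ∧ IsShiftMinimal A

/-- For `J ⊆ ι`, the coordinate subspace `𝔽₂^J` of `𝔽₂^ι`: the vectors vanishing off `J`. -/
def coordSubspace {ι : Type*} (J : Set ι) : Submodule (ZMod 2) (ι → ZMod 2) where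
  carrier := {x | ∀ i, i ∉ J → x i = 0}
  add_mem' := by
    intro a b ha hb i hi
    simp [ha i hi, hb i hi]
  zero_mem' := by
    intro i _
    rfl
  smul_mem' := by
    intro c x hx i hi
    simp [hx i hi]

/-- `𝔽₂^m` inside `𝔽₂^n`: the vectors supported on the first `m` coordinates. -/
def initialSubspace (n m : ℕ) : Submodule (ZMod 2) (Fin n → ZMod 2) :=
  coordSubspace {i : Fin n | (i : ℕ) < m}

/-- The doubling constant `σ[A] = |A + A| / |A|`, as a real number. -/
noncomputable def doublingConst {G : Type*} [AddCommGroup G] [DecidableEq G]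
    (A : Finset G) : ℝ :=
  (#(A + A) : ℝ) / (#A : ℝ)

/-! Let `h i` be the entropy of coordinate `i` of a uniform element of `A` given the earlier
coordinates, so that `log₂ |A| = ∑ h i`. Being a downset makes all conditional biases at most `1/2`;
shift-minimality then makes `h` antitone (`IsSMD.condEntropy_antitone`). Adding two independent bits
gains entropy unless both are nearly constant or nearly fair (`binEntropyBits_conv`); summed over
coordinates this gives `log₂ σ[A] ≥ (2/29) ∑ h i (1 - h i)` (`sum_condEntropy_le_logb_card_add`).

Put `m = ⌊log₂ |A|⌋`. As `h` is antitone, either `h i ≥ 1/2` for all `i < m` or `h i ≤ 1/2` for all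
`i ≥ m`. Either way the entropy beyond the first `m` coordinates is at most `29 log₂ σ[A] + 1`, so
the slice of `A` in `𝔽₂^m` is large. Its sums with the complementary slice `T` are distinct elements
of `A + A`, so `|T| ≤ 2 σ[A]^30`; and `T + 𝔽₂^m` covers the downset `A`. -/

/-! ### Binary entropy and the gain from adding independent bits. -/

/-- The binary entropy function, in bits. -/
noncomputable def binEntropyBits (p : ℝ) : ℝ := Real.binEntropy p / Real.log 2

theorem binEntropyBits_nonneg {p : ℝ} (h0 : 0 ≤ p) (h1 : p ≤ 1) : 0 ≤ binEntropyBits p :=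
  div_nonneg (Real.binEntropy_nonneg h0 h1) (Real.log_nonneg one_le_two)

theorem binEntropyBits_le_one (p : ℝ) : binEntropyBits p ≤ 1 :=
  div_le_one_of_le₀ Real.binEntropy_le_log_two (Real.log_nonneg one_le_two)

theorem binEntropyBits_zero : binEntropyBits 0 = 0 := by simp [binEntropyBits]

theorem binEntropyBits_half : binEntropyBits (1 / 2) = 1 := by
  have : Real.log 2 ≠ 0 := (Real.log_pos one_lt_two).ne'
  rw [binEntropyBits, one_div, Real.binEntropy_two_inv, div_self this]

theorem binEntropyBits_mono {p q : ℝ} (h0 : 0 ≤ p) (h : p ≤ q) (h1 : q ≤ 1 / 2) :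
    binEntropyBits p ≤ binEntropyBits q := by
  refine div_le_div_of_nonneg_right ?_ (Real.log_nonneg one_le_two)
  exact Real.binEntropy_strictMonoOn.monotoneOn ⟨h0, by linarith⟩ ⟨h0.trans h, by linarith⟩ h

theorem concaveOn_binEntropyBits : ConcaveOn ℝ (Set.Icc 0 1) binEntropyBits := by
  have := Real.strictConcave_binEntropy.concaveOn.smul
    (inv_nonneg.2 (Real.log_nonneg one_le_two : 0 ≤ Real.log 2))
  have h : binEntropyBits = fun p => (Real.log 2)⁻¹ • Real.binEntropy p := by
    ext p
    rw [binEntropyBits, div_eq_inv_mul, smul_eq_mul]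
  rwa [h]

/-- Gibbs' inequality on a two-point space. -/
theorem binEntropy_add_le_log_add {s x y : ℝ} (h0 : 0 ≤ s) (h1 : s ≤ 1) (hx : 0 < x)
    (hy : 0 ≤ y) (hys : y = 0 → s = 0) :
    Real.binEntropy s + (1 - s) * Real.log x + s * Real.log y ≤ Real.log (x + y) := by
  rcases h0.eq_or_lt with rfl | h0
  · simpa using Real.log_le_log hx (by linarith)
  have hy' : 0 < y := hy.lt_of_ne fun h => h0.ne' (hys h.symm)
  rcases h1.eq_or_lt with rfl | h1
  · simpa using Real.log_le_log hy' (by linarith)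
  have h1' : 0 < 1 - s := by linarith
  have := strictConcaveOn_log_Ioi.concaveOn.2 (show x / (1 - s) ∈ Set.Ioi 0 from div_pos hx h1')
    (show y / s ∈ Set.Ioi 0 from div_pos hy' h0) h1'.le h0.le (by ring)
  simp only [smul_eq_mul, mul_div_cancel₀ _ h1'.ne', mul_div_cancel₀ _ h0.ne'] at this
  rw [Real.log_div hx.ne' h1'.ne', Real.log_div hy'.ne' h0.ne'] at this
  rw [Real.binEntropy_eq_negMulLog_add_negMulLog_one_sub, Real.negMulLog, Real.negMulLog]
  linarith

/-- The equality case of Gibbs' inequality, attained at the true proportion `s = y / (x + y)`. -/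
theorem log_add_eq_binEntropy_add {x y : ℝ} (hx : 0 < x) (hy : 0 ≤ y) :
    Real.log (x + y) = Real.binEntropy (y / (x + y)) + (1 - y / (x + y)) * Real.log x
      + y / (x + y) * Real.log y := by
  rcases hy.eq_or_lt with rfl | hy
  · simp
  have hxy : 0 < x + y := by linarith
  have h1 : 1 - y / (x + y) = x / (x + y) := by field_simp; ring
  rw [Real.binEntropy_eq_negMulLog_add_negMulLog_one_sub, Real.negMulLog, Real.negMulLog, h1,
    Real.log_div hx.ne' hxy.ne', Real.log_div hy.ne' hxy.ne']
  field_simp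
  ring

theorem binEntropyBits_add_le_logb_add {s x y : ℝ} (h0 : 0 ≤ s) (h1 : s ≤ 1) (hx : 0 < x)
    (hy : 0 ≤ y) (hys : y = 0 → s = 0) :
    binEntropyBits s + (1 - s) * Real.logb 2 x + s * Real.logb 2 y ≤ Real.logb 2 (x + y) := by
  have := div_le_div_of_nonneg_right (binEntropy_add_le_log_add h0 h1 hx hy hys)
    (Real.log_nonneg one_le_two)
  simpa only [binEntropyBits, Real.logb, add_div, mul_div_assoc] using this

theorem logb_add_eq_binEntropyBits_add {x y : ℝ} (hx : 0 < x) (hy : 0 ≤ y) :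
    Real.logb 2 (x + y) = binEntropyBits (y / (x + y)) + (1 - y / (x + y)) * Real.logb 2 x
      + y / (x + y) * Real.logb 2 y := by
  have := congrArg (· / Real.log 2) (log_add_eq_binEntropy_add hx hy)
  simpa only [binEntropyBits, Real.logb, add_div, mul_div_assoc] using this

theorem mul_log_inv_le_binEntropy {p : ℝ} (h0 : 0 ≤ p) (h1 : p ≤ 1) :
    p * -Real.log p ≤ Real.binEntropy p := by
  rw [Real.binEntropy_eq_negMulLog_add_negMulLog_one_sub]
  have := Real.negMulLog_nonneg (sub_nonneg.2 h1) (by linarith)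
  simp only [Real.negMulLog] at *
  linarith

theorem binEntropy_le_mul_log_inv_add {p : ℝ} (h1 : p < 1) :
    Real.binEntropy p ≤ p * (-Real.log p + 1) := by
  rw [Real.binEntropy_eq_negMulLog_add_negMulLog_one_sub]
  have h : 0 < 1 - p := by linarith
  have h2 := Real.one_sub_inv_le_log_of_pos h
  have h3 := mul_le_mul_of_nonneg_left h2 h.le
  rw [mul_sub, mul_inv_cancel₀ h.ne'] at h3
  simp only [Real.negMulLog] at *
  linarith

/-- `p + q - 2pq` is the bias of the sum of two independent bits of biases `p` and `q`. -/
theorem binEntropyBits_conv_of_le {p q : ℝ} (h0 : 0 ≤ p) (hpq : p ≤ q) (h1 : q ≤ 1 / 2) :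
    (binEntropyBits p + binEntropyBits q) / 2
      + 1 / 29 * (binEntropyBits p * (1 - binEntropyBits q)
        + binEntropyBits q * (1 - binEntropyBits p)) ≤ binEntropyBits (p + q - 2 * p * q) := by
  have hl := Real.log_two_gt_d9
  have hl' := Real.log_two_lt_d9
  have hlpos : 0 < Real.log 2 := by linarith
  have hr1 : p + q - 2 * p * q ≤ 1 / 2 := by nlinarith
  have hr0 : q ≤ p + q - 2 * p * q := by nlinarith
  have ha0 := binEntropyBits_nonneg h0 (by linarith)
  have hb1 := binEntropyBits_le_one q
  have hab := binEntropyBits_mono h0 hpq h1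
  have hbr := binEntropyBits_mono (h0.trans hpq) hr0 hr1
  rcases h0.eq_or_lt with rfl | hp
  · rw [binEntropyBits_zero] at *
    rw [show 0 + q - 2 * 0 * q = q by ring]
    linarith
  have hq : 0 < q := hp.trans_le hpq
  -- The constant `1/29` is tested in three regimes: `p` not tiny (concavity), `p` tiny with `q ≥
  -- 3p` (the larger entropy far exceeds the average), and both tiny and comparable (the sum's bias
  -- exceeds `q` by a constant factor).
  rcases le_or_gt (1 / 4096) p with h | h
  · -- compare on the chord from `q` to `1 / 2`
    have hc := concaveOn_binEntropyBits.2 (show q ∈ Set.Icc (0 : ℝ) 1 by constructor <;> linarith)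
      (show (1 / 2 : ℝ) ∈ Set.Icc (0 : ℝ) 1 by norm_num)
      (show 0 ≤ 1 - 2 * p by linarith) (show 0 ≤ 2 * p by linarith) (by ring)
    simp only [smul_eq_mul, binEntropyBits_half] at hc
    rw [show (1 - 2 * p) * q + 2 * p * (1 / 2) = p + q - 2 * p * q by ring] at hc
    have hp29 : binEntropyBits p ≤ 29 * p := by
      rw [binEntropyBits, div_le_iff₀ hlpos]
      have h2 := binEntropy_le_mul_log_inv_add (by linarith : p < 1)
      have h3 : -Real.log p ≤ 12 * Real.log 2 := by
        have := Real.log_le_log (by norm_num) h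
        rw [show (1 / 4096 : ℝ) = (2 ^ 12)⁻¹ by norm_num, Real.log_inv, Real.log_pow] at this
        push_cast at this
        linarith
      nlinarith
    nlinarith
  have hL : 12 * Real.log 2 ≤ -Real.log p := by
    have := Real.log_le_log hp h.le
    rw [show (1 / 4096 : ℝ) = (2 ^ 12)⁻¹ by norm_num, Real.log_inv, Real.log_pow] at this
    push_cast at this
    linarith
  have hlog4 : Real.log 4 = 2 * Real.log 2 := by
    rw [show (4 : ℝ) = 2 ^ 2 by norm_num, Real.log_pow]; norm_num
  have hlog3 : Real.log 3 ≤ 2 * Real.log 2 := by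
    rw [← hlog4]; exact Real.log_le_log (by norm_num) (by norm_num)
  rcases le_or_gt (3 * p) q with h3 | h3
  · have hb : 2 * binEntropyBits p ≤ binEntropyBits q := by
      refine le_trans ?_ (binEntropyBits_mono (by linarith) h3 h1)
      rw [binEntropyBits, binEntropyBits, ← mul_div_assoc]
      refine div_le_div_of_nonneg_right ?_ hlpos.le
      have h4 := binEntropy_le_mul_log_inv_add (by linarith : p < 1)
      have h5 := mul_log_inv_le_binEntropy (by linarith : 0 ≤ 3 * p) (by linarith)
      rw [Real.log_mul (by norm_num) hp.ne'] at h5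
      nlinarith
    nlinarith
  · have hLq : 10 * Real.log 2 ≤ -Real.log q := by
      have := Real.log_le_log hq h3.le
      rw [Real.log_mul (by norm_num) hp.ne'] at this
      linarith
    -- Since `p > q/3` and `q` is tiny, `p + q - 2pq ≥ 1.3 q`; near zero the entropy is almost
    -- linear, so most of the factor `1.3` survives.
    have hb : (1 + 2 / 29) * binEntropyBits q ≤ binEntropyBits (p + q - 2 * p * q) := by
      refine le_trans ?_ (binEntropyBits_mono (by linarith : 0 ≤ 13 / 10 * q)
        (by nlinarith) hr1)
      rw [binEntropyBits, binEntropyBits, ← mul_div_assoc]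
      refine div_le_div_of_nonneg_right ?_ hlpos.le
      have h4 := binEntropy_le_mul_log_inv_add (by linarith : q < 1)
      have h5 := mul_log_inv_le_binEntropy (by linarith : 0 ≤ 13 / 10 * q) (by linarith)
      rw [Real.log_mul (by norm_num) hq.ne'] at h5
      have h6 := Real.log_le_sub_one_of_pos (show (0 : ℝ) < 13 / 10 by norm_num)
      nlinarith
    nlinarith

theorem binEntropyBits_conv {p q : ℝ} (hp : 0 ≤ p) (hp' : p ≤ 1 / 2) (hq : 0 ≤ q)
    (hq' : q ≤ 1 / 2) :
    (binEntropyBits p + binEntropyBits q) / 2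
      + 1 / 29 * (binEntropyBits p * (1 - binEntropyBits q)
        + binEntropyBits q * (1 - binEntropyBits p)) ≤ binEntropyBits (p + q - 2 * p * q) := by
  rcases le_total p q with h | h
  · exact binEntropyBits_conv_of_le hp h hq'
  · have := binEntropyBits_conv_of_le hq h hp'
    rw [show q + p - 2 * q * p = p + q - 2 * p * q by ring] at this
    linarith

theorem logb_natCast_mono {a b : ℕ} (h : a ≤ b) : Real.logb 2 a ≤ Real.logb 2 b := by
  rcases a.eq_zero_or_pos with rfl | ha
  · rw [Nat.cast_zero, Real.logb_zero]
    exact div_nonneg (Real.log_natCast_nonneg b) (Real.log_nonneg one_le_two)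
  · exact Real.logb_le_logb_of_le one_lt_two (by exact_mod_cast ha) (by exact_mod_cast h)

/-! ### Fibres over the first coordinate. -/

section HeadFiber

variable {n : ℕ}

/-- The fibre of `A` over the value `b` of the first coordinate. -/
def headFiber (A : Finset (Fin (n + 1) → ZMod 2)) (b : ZMod 2) : Finset (Fin n → ZMod 2) :=
  univ.filter fun x => Matrix.vecCons b x ∈ A

theorem mem_headFiber {A : Finset (Fin (n + 1) → ZMod 2)} {b : ZMod 2} {x : Fin n → ZMod 2} :
    x ∈ headFiber A b ↔ Matrix.vecCons b x ∈ A := by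
  simp [headFiber]

theorem eq_zero_or_one_of_zmod_two (b : ZMod 2) : b = 0 ∨ b = 1 := by
  revert b; decide

theorem card_filter_eq_headFiber (A : Finset (Fin (n + 1) → ZMod 2)) (b : ZMod 2) :
    #(A.filter fun x => x 0 = b) = #(headFiber A b) := by
  refine (card_nbij' (Matrix.vecCons b) Matrix.vecTail ?_ ?_ ?_ ?_).symm
  · intro x hx
    simpa [mem_headFiber] using hx
  · intro x hx
    obtain ⟨h, rfl⟩ := mem_filter.1 (mem_coe.1 hx)
    rw [mem_coe, mem_headFiber]
    exact (Matrix.cons_head_tail x).symm ▸ h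
  · intro x _
    simp
  · intro x hx
    obtain ⟨-, rfl⟩ := mem_filter.1 (mem_coe.1 hx)
    exact Matrix.cons_head_tail x

theorem card_eq_headFiber_add (A : Finset (Fin (n + 1) → ZMod 2)) :
    #A = #(headFiber A 0) + #(headFiber A 1) := by
  rw [← card_filter_eq_headFiber, ← card_filter_eq_headFiber,
    ← card_filter_add_card_filter_not (s := A) (fun x => x 0 = 0)]
  congr 2
  ext x
  rcases eq_zero_or_one_of_zmod_two (x 0) with h | h <;> simp [h]

theorem vecCons_add_single_succ (b : ZMod 2) (x : Fin n → ZMod 2) (i : Fin n) :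
    Matrix.vecCons b x + Pi.single i.succ 1 = Matrix.vecCons b (x + Pi.single i 1) := by
  ext j
  refine Fin.cases ?_ (fun j => ?_) j
  · simp
  · simp [Pi.single_apply]

theorem vecCons_zero_add_single (x : Fin n → ZMod 2) :
    Matrix.vecCons 0 x + Pi.single 0 1 = Matrix.vecCons (1 : ZMod 2) x := by
  ext j
  refine Fin.cases ?_ (fun j => ?_) j
  · simp
  · simp

theorem IsDownset.headFiber {A : Finset (Fin (n + 1) → ZMod 2)} (hA : IsDownset A) (b : ZMod 2) :
    IsDownset (headFiber A b) := by
  intro i x hx h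
  rw [mem_headFiber] at *
  rw [← vecCons_add_single_succ] at h
  exact hA i.succ _ (by simpa using hx) h

theorem IsSMD.headFiber {A : Finset (Fin (n + 1) → ZMod 2)} (hA : IsSMD A) (b : ZMod 2) :
    IsSMD (headFiber A b) := by
  refine ⟨hA.1.headFiber b, fun i j x hij hi hj h => ?_⟩
  rw [mem_headFiber] at *
  rw [← vecCons_add_single_succ] at *
  exact hA.2 i.succ j.succ _ (Fin.succ_lt_succ_iff.2 hij) (by simpa using hi) (by simpa using hj) h

theorem IsDownset.headFiber_subset {A : Finset (Fin (n + 1) → ZMod 2)} (hA : IsDownset A) :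
    _root_.headFiber A 1 ⊆ _root_.headFiber A 0 := by
  intro x hx
  rw [mem_headFiber] at *
  rw [← vecCons_zero_add_single] at hx
  exact hA 0 _ (by simp) hx

theorem IsShiftMinimal.headFiber_headFiber_subset {A : Finset (Fin (n + 2) → ZMod 2)}
    (hA : IsShiftMinimal A) :
    headFiber (headFiber A 0) 1 ⊆ headFiber (headFiber A 1) 0 := by
  intro x hx
  simp only [mem_headFiber] at *
  rw [← vecCons_zero_add_single x, ← vecCons_add_single_succ] at hx
  rw [← vecCons_zero_add_single]
  exact hA 0 (Fin.succ 0) _ (by simp) (by simp) (by simp) hx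

theorem IsDownset.headFiber_zero_nonempty {A : Finset (Fin (n + 1) → ZMod 2)} (hA : IsDownset A)
    (hne : A.Nonempty) : (_root_.headFiber A 0).Nonempty := by
  rw [← card_pos] at hne ⊢
  have := card_le_card hA.headFiber_subset
  have := card_eq_headFiber_add A
  omega

theorem headFiber_add_subset (A B : Finset (Fin (n + 1) → ZMod 2)) (a b : ZMod 2) :
    headFiber A a + headFiber B b ⊆ headFiber (A + B) (a + b) := by
  intro x hx
  obtain ⟨y, hy, z, hz, rfl⟩ := mem_add.1 hx
  rw [mem_headFiber] at *
  exact mem_add.2 ⟨_, hy, _, hz, by rw [Matrix.cons_add_cons]⟩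

/-- The proportion of elements of `A` with first coordinate `1`. -/
noncomputable def headBias (A : Finset (Fin (n + 1) → ZMod 2)) : ℝ :=
  (#(headFiber A 1) : ℝ) / #A

theorem headBias_nonneg (A : Finset (Fin (n + 1) → ZMod 2)) : 0 ≤ headBias A := by
  unfold headBias; positivity

theorem headBias_le_one (A : Finset (Fin (n + 1) → ZMod 2)) : headBias A ≤ 1 := by
  refine div_le_one_of_le₀ ?_ (by positivity)
  rw [card_eq_headFiber_add A]
  exact_mod_cast Nat.le_add_left _ _

theorem IsDownset.headBias_le_half {A : Finset (Fin (n + 1) → ZMod 2)} (hA : IsDownset A) :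
    headBias A ≤ 1 / 2 := by
  refine div_le_of_le_mul₀ (by positivity) (by norm_num) ?_
  have h : (#(_root_.headFiber A 1) : ℝ) ≤ #(_root_.headFiber A 0) := by
    exact_mod_cast card_le_card hA.headFiber_subset
  rw [card_eq_headFiber_add A]
  push_cast
  linarith

theorem headBias_mul_card (A : Finset (Fin (n + 1) → ZMod 2)) :
    headBias A * #A = #(headFiber A 1) := by
  rcases A.eq_empty_or_nonempty with rfl | h
  · simp [headFiber]
  · exact div_mul_cancel₀ _ (by exact_mod_cast h.card_ne_zero)

theorem one_sub_headBias {A : Finset (Fin (n + 1) → ZMod 2)} (h : A.Nonempty) :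
    1 - headBias A = (#(headFiber A 0) : ℝ) / #A := by
  have h0 : (#A : ℝ) ≠ 0 := by exact_mod_cast h.card_ne_zero
  have h1 : (#A : ℝ) = #(headFiber A 0) + #(headFiber A 1) := by
    exact_mod_cast card_eq_headFiber_add A
  rw [headBias, eq_div_iff h0, sub_mul, div_mul_cancel₀ _ h0]
  linarith

theorem headBias_eq_zero_of_not_nonempty {A : Finset (Fin (n + 1) → ZMod 2)}
    (h : ¬ (headFiber A 1).Nonempty) : headBias A = 0 := by
  rw [not_nonempty_iff_eq_empty] at h
  simp [headBias, h]

end HeadFiber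

/-! ### Conditional entropies and their monotonicity. -/

/-- The conditional entropy, in bits, of coordinate `i` of a uniform random element of `A` given
the preceding coordinates. -/
noncomputable def condEntropy : {n : ℕ} → ℕ → Finset (Fin n → ZMod 2) → ℝ
  | 0, _, _ => 0
  | _ + 1, 0, A => binEntropyBits (headBias A)
  | _ + 1, i + 1, A => (1 - headBias A) * condEntropy i (headFiber A 0)
      + headBias A * condEntropy i (headFiber A 1)

theorem condEntropy_nonneg {n : ℕ} (i : ℕ) (A : Finset (Fin n → ZMod 2)) :
    0 ≤ condEntropy i A := by
  induction n generalizing i with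
  | zero => simp [condEntropy]
  | succ n ih =>
    cases i with
    | zero => exact binEntropyBits_nonneg (headBias_nonneg A) (headBias_le_one A)
    | succ i =>
      exact add_nonneg (mul_nonneg (sub_nonneg.2 (headBias_le_one A)) (ih _ _))
        (mul_nonneg (headBias_nonneg A) (ih _ _))

theorem condEntropy_le_one {n : ℕ} (i : ℕ) (A : Finset (Fin n → ZMod 2)) :
    condEntropy i A ≤ 1 := by
  induction n generalizing i with
  | zero => simp [condEntropy]
  | succ n ih =>
    cases i with
    | zero => exact binEntropyBits_le_one _
    | succ i =>
      have h0 := headBias_nonneg A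
      have h1 := headBias_le_one A
      rw [condEntropy]
      nlinarith [ih i (headFiber A 0), ih i (headFiber A 1)]

theorem condEntropy_eq_zero_of_le {n i : ℕ} (h : n ≤ i) (A : Finset (Fin n → ZMod 2)) :
    condEntropy i A = 0 := by
  induction n generalizing i with
  | zero => simp [condEntropy]
  | succ n ih =>
    obtain ⟨i, rfl⟩ : ∃ j, i = j + 1 := ⟨i - 1, by omega⟩
    rw [condEntropy, ih (by omega), ih (by omega)]
    ring

/-- The chain rule for the entropy of the uniform distribution on a downset. -/
theorem logb_card_eq_sum_condEntropy {n : ℕ} {A : Finset (Fin n → ZMod 2)} (hA : IsDownset A)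
    (hne : A.Nonempty) : Real.logb 2 #A = ∑ i ∈ range n, condEntropy i A := by
  induction n with
  | zero =>
    have : #A = 1 := le_antisymm (by simpa using card_le_univ A) hne.card_pos
    simp [this]
  | succ n ih =>
    have h0 := hA.headFiber_zero_nonempty hne
    have hcard : (#A : ℝ) = #(headFiber A 0) + #(headFiber A 1) := by
      exact_mod_cast card_eq_headFiber_add A
    have h1 : headBias A * Real.logb 2 #(headFiber A 1)
        = headBias A * ∑ i ∈ range n, condEntropy i (headFiber A 1) := by
      by_cases h : (headFiber A 1).Nonempty
      · rw [ih (hA.headFiber 1) h]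
      · simp [headBias_eq_zero_of_not_nonempty h]
    have key := logb_add_eq_binEntropyBits_add (x := #(headFiber A 0)) (y := #(headFiber A 1))
      (by exact_mod_cast h0.card_pos) (by positivity)
    rw [← hcard] at key
    rw [sum_range_succ', key]
    change binEntropyBits (headBias A) + (1 - headBias A) * _ + headBias A * _ = _
    rw [h1, ih (hA.headFiber 0) h0, mul_sum, mul_sum, add_assoc, ← sum_add_distrib, add_comm]
    rfl

/-- Conditioning lowers entropy (Jensen), and shift-minimality makes the second coordinate's bias at
most the first's, which is at most `1/2`, where entropy is increasing. -/
theorem condEntropy_one_le_condEntropy_zero {n : ℕ} {A : Finset (Fin n → ZMod 2)}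
    (hA : IsSMD A) : condEntropy 1 A ≤ condEntropy 0 A := by
  rcases A.eq_empty_or_nonempty with rfl | hne
  · cases n with
    | zero => simp [condEntropy]
    | succ n => cases n <;>
        simp [condEntropy, headBias, headFiber, binEntropyBits_zero]
  match n, A, hA, hne with
  | 0, A, hA, hne => simp [condEntropy]
  | 1, A, hA, hne =>
    rw [condEntropy_eq_zero_of_le le_rfl]
    exact condEntropy_nonneg _ _
  | n + 2, A, hA, hne =>
    have h0 := headBias_nonneg A
    have h1 := headBias_le_one A
    have hc := concaveOn_binEntropyBits.2
      ⟨headBias_nonneg (headFiber A 0), headBias_le_one (headFiber A 0)⟩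
      ⟨headBias_nonneg (headFiber A 1), headBias_le_one (headFiber A 1)⟩
      (sub_nonneg.2 h1) h0 (by ring)
    simp only [smul_eq_mul] at hc
    change (1 - headBias A) * binEntropyBits _ + headBias A * binEntropyBits _
      ≤ binEntropyBits (headBias A)
    refine hc.trans (binEntropyBits_mono ?_ ?_ hA.1.headBias_le_half)
    · exact add_nonneg (mul_nonneg (sub_nonneg.2 h1) (headBias_nonneg _))
        (mul_nonneg h0 (headBias_nonneg _))
    · have e0 := headBias_mul_card (headFiber A 0)
      have e1 := headBias_mul_card (headFiber A 1)
      have hpos : (0 : ℝ) < #A := by exact_mod_cast hne.card_pos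
      rw [one_sub_headBias hne]
      unfold headBias at e0 e1 ⊢
      rw [div_mul_eq_mul_div, div_mul_eq_mul_div, ← add_div, mul_comm, e0, mul_comm, e1]
      refine div_le_div_of_nonneg_right ?_ hpos.le
      have h2 := card_le_card hA.2.headFiber_headFiber_subset
      have h3 := card_eq_headFiber_add (headFiber A 1)
      exact_mod_cast (by omega :
        #(headFiber (headFiber A 0) 1) + #(headFiber (headFiber A 1) 1) ≤ #(headFiber A 1))

/-- Fibres of an SMD are SMDs and later conditional entropies are averages over fibres, so only the
first two coordinates need comparing. -/
theorem IsSMD.condEntropy_antitone {n : ℕ} {A : Finset (Fin n → ZMod 2)} (hA : IsSMD A) :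
    Antitone fun i => condEntropy i A := by
  refine antitone_nat_of_succ_le fun i => ?_
  induction n generalizing i with
  | zero => simp [condEntropy]
  | succ n ih =>
    cases i with
    | zero => exact condEntropy_one_le_condEntropy_zero hA
    | succ i =>
      exact add_le_add
        (mul_le_mul_of_nonneg_left (ih (hA.headFiber 0) i) (sub_nonneg.2 (headBias_le_one A)))
        (mul_le_mul_of_nonneg_left (ih (hA.headFiber 1) i) (headBias_nonneg A))

/-! ### Entropy gain in sumsets. -/

theorem logb_card_le_logb_card {α : Type*} {s t : Finset α} (h : s ⊆ t) :
    Real.logb 2 #s ≤ Real.logb 2 #t :=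
  logb_natCast_mono (card_le_card h)

/-- The increment, in the chain rule for `A + B`, coming from the first coordinate. -/
theorem binEntropyBits_add_le_logb_card_add {n : ℕ} {A B : Finset (Fin (n + 1) → ZMod 2)}
    (hA : IsDownset A) (hB : IsDownset B) (hAne : A.Nonempty) (hBne : B.Nonempty) :
    binEntropyBits (headBias A + headBias B - 2 * headBias A * headBias B)
      + (1 - headBias A) * (1 - headBias B) * Real.logb 2 #(headFiber A 0 + headFiber B 0)
      + (1 - headBias A) * headBias B * Real.logb 2 #(headFiber A 0 + headFiber B 1)
      + headBias A * (1 - headBias B) * Real.logb 2 #(headFiber A 1 + headFiber B 0)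
      + headBias A * headBias B * Real.logb 2 #(headFiber A 1 + headFiber B 1)
      ≤ Real.logb 2 #(A + B) := by
  have hp := headBias_nonneg A
  have hp' := hA.headBias_le_half
  have hq := headBias_nonneg B
  have hq' := hB.headBias_le_half
  set p := headBias A with hpdef
  set q := headBias B with hqdef
  have s00 := headFiber_add_subset A B 0 0
  have s01 := headFiber_add_subset A B 0 1
  have s10 := headFiber_add_subset A B 1 0
  have s11 := headFiber_add_subset A B 1 1
  rw [add_zero] at s00 s10
  rw [zero_add] at s01
  rw [show (1 + 1 : ZMod 2) = 0 from rfl] at s11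
  have hA0 := hA.headFiber_zero_nonempty hAne
  have hB0 := hB.headFiber_zero_nonempty hBne
  have h0 : 0 < #(headFiber (A + B) 0) := ((hA0.add hB0).mono s00).card_pos
  -- The weight `s` is the probability that the first coordinate of `X + Y` is `1`, for independent
  -- uniform `X ∈ A`, `Y ∈ B`. Each fibre of `A + B` contains two sums of fibres, whose weights add
  -- up to `1 - s` or `s`.
  have key := binEntropyBits_add_le_logb_add (s := p + q - 2 * p * q)
    (x := #(headFiber (A + B) 0)) (y := #(headFiber (A + B) 1)) (by nlinarith) (by nlinarith)
    (by exact_mod_cast h0) (by positivity) (by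
      intro h
      rw [Nat.cast_eq_zero, card_eq_zero] at h
      have hp0 : p = 0 := headBias_eq_zero_of_not_nonempty fun h1 =>
        ((h1.add hB0).mono s10).ne_empty h
      have hq0 : q = 0 := headBias_eq_zero_of_not_nonempty fun h1 =>
        ((hA0.add h1).mono s01).ne_empty h
      rw [hp0, hq0]
      ring)
  rw [show (#(headFiber (A + B) 0) : ℝ) + #(headFiber (A + B) 1) = #(A + B) by
    exact_mod_cast (card_eq_headFiber_add (A + B)).symm] at key
  have m00 := mul_le_mul_of_nonneg_left (logb_card_le_logb_card s00)
    (mul_nonneg (by linarith : 0 ≤ 1 - p) (by linarith : 0 ≤ 1 - q))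
  have m01 := mul_le_mul_of_nonneg_left (logb_card_le_logb_card s01)
    (mul_nonneg (by linarith : 0 ≤ 1 - p) hq)
  have m10 := mul_le_mul_of_nonneg_left (logb_card_le_logb_card s10)
    (mul_nonneg hp (by linarith : 0 ≤ 1 - q))
  have m11 := mul_le_mul_of_nonneg_left (logb_card_le_logb_card s11) (mul_nonneg hp hq)
  linarith

/-- The entropy gain of `A + B` over `A` and `B`, coordinate by coordinate. -/
theorem sum_condEntropy_le_logb_card_add {n : ℕ} {A B : Finset (Fin n → ZMod 2)}
    (hA : IsDownset A) (hB : IsDownset B) (hAne : A.Nonempty) (hBne : B.Nonempty) :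
    ∑ i ∈ range n, ((condEntropy i A + condEntropy i B) / 2
        + 1 / 29 * (condEntropy i A * (1 - condEntropy i B)
          + condEntropy i B * (1 - condEntropy i A))) ≤ Real.logb 2 #(A + B) := by
  induction n with
  | zero =>
    have := logb_natCast_mono (hAne.add hBne).card_pos
    simpa using this
  | succ n ih =>
    refine le_trans ?_ (binEntropyBits_add_le_logb_card_add hA hB hAne hBne)
    have hp := headBias_nonneg A
    have hp' := hA.headBias_le_half
    have hq := headBias_nonneg B
    have hq' := hB.headBias_le_half
    have hconv := binEntropyBits_conv hp hp' hq hq'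
    have hA0 := hA.headFiber_zero_nonempty hAne
    have hB0 := hB.headFiber_zero_nonempty hBne
    -- A fibre over `1` may be empty, but then its weight vanishes.
    have ih_mul : ∀ (w : ℝ) (a b : ZMod 2), 0 ≤ w → (w ≠ 0 → (headFiber A a).Nonempty) →
        (w ≠ 0 → (headFiber B b).Nonempty) →
        w * ∑ i ∈ range n, ((condEntropy i (headFiber A a) + condEntropy i (headFiber B b)) / 2
          + 1 / 29 * (condEntropy i (headFiber A a) * (1 - condEntropy i (headFiber B b))
            + condEntropy i (headFiber B b) * (1 - condEntropy i (headFiber A a))))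
          ≤ w * Real.logb 2 #(headFiber A a + headFiber B b) := by
      intro w a b hw ha hb
      rcases eq_or_ne w 0 with rfl | h
      · simp only [zero_mul, le_refl]
      · exact mul_le_mul_of_nonneg_left (ih (hA.headFiber a) (hB.headFiber b) (ha h) (hb h)) hw
    have hA1 : headBias A ≠ 0 → (headFiber A 1).Nonempty := not_imp_comm.1
      headBias_eq_zero_of_not_nonempty
    have hB1 : headBias B ≠ 0 → (headFiber B 1).Nonempty := not_imp_comm.1
      headBias_eq_zero_of_not_nonempty
    have hp1 : 0 ≤ 1 - headBias A := by linarith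
    have hq1 : 0 ≤ 1 - headBias B := by linarith
    have i00 := ih_mul _ 0 0 (mul_nonneg hp1 hq1) (fun _ => hA0) (fun _ => hB0)
    have i01 := ih_mul _ 0 1 (mul_nonneg hp1 hq) (fun _ => hA0)
      (fun h => hB1 (right_ne_zero_of_mul h))
    have i10 := ih_mul _ 1 0 (mul_nonneg hp hq1) (fun h => hA1 (left_ne_zero_of_mul h))
      (fun _ => hB0)
    have i11 := ih_mul _ 1 1 (mul_nonneg hp hq) (fun h => hA1 (left_ne_zero_of_mul h))
      (fun h => hB1 (right_ne_zero_of_mul h))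
    refine le_trans (le_of_eq ?_)
      (add_le_add (add_le_add (add_le_add (add_le_add hconv i00) i01) i10) i11)
    conv_rhs => rw [mul_sum, mul_sum, mul_sum, mul_sum, add_assoc, add_assoc, add_assoc,
      ← sum_add_distrib, ← sum_add_distrib, ← sum_add_distrib]
    rw [sum_range_succ', add_comm]
    -- The gain is affine in each of the two entropies separately, so averaging over pairs of fibres
    -- with product weights reproduces it exactly. Distinct fibres get paired, hence the induction
    -- on two sets.
    refine congrArg₂ (· + ·) rfl (sum_congr rfl fun i _ => ?_)
    simp only [condEntropy]
    ring

/-! ### Complementary slices and the covering. -/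

/-- The slice of `A` on which every coordinate from `m` on vanishes. -/
def initialSlice {n : ℕ} (m : ℕ) (A : Finset (Fin n → ZMod 2)) : Finset (Fin n → ZMod 2) :=
  A.filter fun x => ∀ i : Fin n, m ≤ i → x i = 0

theorem headFiber_initialSlice {n : ℕ} (m : ℕ) (A : Finset (Fin (n + 1) → ZMod 2)) (b : ZMod 2) :
    headFiber (initialSlice (m + 1) A) b = initialSlice m (headFiber A b) := by
  ext x
  simp [mem_headFiber, initialSlice, Fin.forall_fin_succ]

theorem IsDownset.zero_mem {n : ℕ} {A : Finset (Fin n → ZMod 2)} (hA : IsDownset A)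
    (hne : A.Nonempty) : 0 ∈ A := by
  induction n with
  | zero =>
    obtain ⟨x, hx⟩ := hne
    rwa [Subsingleton.elim 0 x]
  | succ n ih =>
    have := ih (hA.headFiber 0) (hA.headFiber_zero_nonempty hne)
    rwa [mem_headFiber, Matrix.cons_zero_zero] at this

theorem IsDownset.zero_mem_initialSlice {n : ℕ} (m : ℕ) {A : Finset (Fin n → ZMod 2)}
    (hA : IsDownset A) (hne : A.Nonempty) : 0 ∈ initialSlice m A :=
  mem_filter.2 ⟨hA.zero_mem hne, fun _ _ => rfl⟩

/-- The sum is the entropy of the first `m` coordinates, and for a downset their projection is the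
slice itself. -/
theorem IsDownset.sum_condEntropy_le_logb_card_initialSlice {n : ℕ} (m : ℕ)
    {A : Finset (Fin n → ZMod 2)} (hA : IsDownset A) (hne : A.Nonempty) :
    ∑ i ∈ range m, condEntropy i A ≤ Real.logb 2 #(initialSlice m A) := by
  induction n generalizing m with
  | zero =>
    have := logb_natCast_mono (card_pos.2 ⟨0, hA.zero_mem_initialSlice m hne⟩)
    simpa [condEntropy] using this
  | succ n ih =>
    cases m with
    | zero =>
      have := logb_natCast_mono (card_pos.2 ⟨0, hA.zero_mem_initialSlice 0 hne⟩)
      simpa using this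
    | succ m =>
      have h0 := hA.headFiber_zero_nonempty hne
      have hpos : ∀ b, (_root_.headFiber A b).Nonempty →
          0 < #(initialSlice m (_root_.headFiber A b)) := fun b hb =>
        card_pos.2 ⟨0, (hA.headFiber b).zero_mem_initialSlice m hb⟩
      have key := binEntropyBits_add_le_logb_add (s := headBias A)
        (x := #(initialSlice m (_root_.headFiber A 0)))
        (y := #(initialSlice m (_root_.headFiber A 1))) (headBias_nonneg A) (headBias_le_one A)
        (by exact_mod_cast hpos 0 h0) (by positivity) (fun h =>
          headBias_eq_zero_of_not_nonempty fun h1 => (hpos 1 h1).ne' (by exact_mod_cast h))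
      have hcard := card_eq_headFiber_add (initialSlice (m + 1) A)
      rw [headFiber_initialSlice, headFiber_initialSlice] at hcard
      rw [← Nat.cast_add, ← hcard] at key
      refine le_trans ?_ key
      have i0 := mul_le_mul_of_nonneg_left (ih m (hA.headFiber 0) h0)
        (sub_nonneg.2 (headBias_le_one A))
      have i1 : headBias A * ∑ i ∈ range m, condEntropy i (_root_.headFiber A 1)
          ≤ headBias A * Real.logb 2 #(initialSlice m (_root_.headFiber A 1)) := by
        by_cases h : (_root_.headFiber A 1).Nonempty
        · exact mul_le_mul_of_nonneg_left (ih m (hA.headFiber 1) h) (headBias_nonneg A)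
        · simp only [headBias_eq_zero_of_not_nonempty h, zero_mul, le_refl]
      refine le_trans (le_of_eq ?_) (add_le_add (add_le_add_right i0 _) i1)
      rw [sum_range_succ', add_comm, mul_sum, mul_sum, add_assoc, ← sum_add_distrib]
      rfl

/-- The slice of `A` on which every coordinate before `m` vanishes. -/
def finalSlice {n : ℕ} (m : ℕ) (A : Finset (Fin n → ZMod 2)) : Finset (Fin n → ZMod 2) :=
  A.filter fun x => ∀ i : Fin n, (i : ℕ) < m → x i = 0

/-- The slices live on disjoint sets of coordinates, so a sum determines both summands. -/
theorem card_finalSlice_mul_card_initialSlice_le {n : ℕ} (m : ℕ) (A : Finset (Fin n → ZMod 2)) :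
    #(finalSlice m A) * #(initialSlice m A) ≤ #(A + A) := by
  rw [← card_product]
  refine card_le_card_of_injOn (fun x => x.1 + x.2) ?_ ?_
  · intro x hx
    obtain ⟨h1, h2⟩ := mem_product.1 (mem_coe.1 hx)
    exact mem_coe.2 (add_mem_add (mem_filter.1 h1).1 (mem_filter.1 h2).1)
  · rintro ⟨x, y⟩ h ⟨x', y'⟩ h' e
    obtain ⟨hx, hy⟩ := mem_product.1 (mem_coe.1 h)
    obtain ⟨hx', hy'⟩ := mem_product.1 (mem_coe.1 h')
    replace hx := (mem_filter.1 hx).2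
    replace hy := (mem_filter.1 hy).2
    replace hx' := (mem_filter.1 hx').2
    replace hy' := (mem_filter.1 hy').2
    simp only at hx hy hx' hy' e
    have e' : ∀ i, x i + y i = x' i + y' i := fun i => congrFun e i
    refine Prod.ext (funext fun i => ?_) (funext fun i => ?_)
    · rcases lt_or_ge (i : ℕ) m with hi | hi
      · simp [hx i hi, hx' i hi]
      · simpa [hy i hi, hy' i hi] using e' i
    · rcases lt_or_ge (i : ℕ) m with hi | hi
      · simpa [hx i hi, hx' i hi] using e' i
      · simp [hy i hi, hy' i hi]

/-- A downset contains every vector obtained from one of its elements by zeroing coordinates. -/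
theorem IsDownset.mem_of_forall_eq_zero_or_eq {n : ℕ} {A : Finset (Fin n → ZMod 2)}
    (hA : IsDownset A) {x y : Fin n → ZMod 2} (hx : x ∈ A) (hy : ∀ i, y i = 0 ∨ y i = x i) :
    y ∈ A := by
  induction n with
  | zero => rwa [Subsingleton.elim y x]
  | succ n ih =>
    rw [← Matrix.cons_head_tail x, ← mem_headFiber] at hx
    rw [← Matrix.cons_head_tail y, ← mem_headFiber]
    refine ih (hA.headFiber _) (x := Matrix.vecTail x) ?_ fun i => hy i.succ
    rcases hy 0 with h | h
    · rw [show Matrix.vecHead y = 0 from h]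
      rcases eq_zero_or_one_of_zmod_two (Matrix.vecHead x) with h' | h' <;> rw [h'] at hx
      · exact hx
      · exact hA.headFiber_subset hx
    · rwa [show Matrix.vecHead y = Matrix.vecHead x from h]

/-- Zeroing the first `m` coordinates of `x ∈ A` stays in `A` and gives the translate containing
`x`. -/
theorem IsDownset.subset_iUnion_finalSlice {n : ℕ} (m : ℕ) {A : Finset (Fin n → ZMod 2)}
    (hA : IsDownset A) : (A : Set (Fin n → ZMod 2)) ⊆
      ⋃ t ∈ finalSlice m A, t +ᵥ (initialSubspace n m : Set (Fin n → ZMod 2)) := by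
  intro x hx
  refine Set.mem_iUnion₂.2 ⟨fun i => if (i : ℕ) < m then 0 else x i, mem_filter.2 ⟨?_, ?_⟩, ?_⟩
  · exact hA.mem_of_forall_eq_zero_or_eq hx fun i => by by_cases h : (i : ℕ) < m <;> simp [h]
  · intro i hi
    simp [hi]
  · refine Set.mem_vadd_set.2 ⟨fun i => if (i : ℕ) < m then x i else 0, ?_, ?_⟩
    · intro i (hi : ¬ (i : ℕ) < m)
      simp [hi]
    · ext i
      by_cases h : (i : ℕ) < m <;> simp [h]

/-! ### Conclusion. -/

/-- An SMD of small doubling has small conditional entropy beyond coordinate `⌊log₂ |A|⌋`. -/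
theorem IsSMD.logb_card_sub_sum_le {n : ℕ} {A : Finset (Fin n → ZMod 2)} (hA : IsSMD A)
    (hne : A.Nonempty) :
    Real.logb 2 #A - ∑ i ∈ range (Nat.log 2 #A), condEntropy i A
      ≤ 29 * (Real.logb 2 #(A + A) - Real.logb 2 #A) + 1 := by
  set m := Nat.log 2 #A with hm
  have hmn : m ≤ n := by
    have h : #A ≤ 2 ^ n := by simpa using card_le_univ A
    exact (Nat.log_mono_right h).trans (Nat.log_pow one_lt_two n).le
  have hlt : Real.logb 2 #A ≤ m + 1 := by
    have h := logb_natCast_mono (Nat.lt_pow_succ_log_self one_lt_two #A).le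
    rw [Nat.cast_pow, Nat.cast_two, Real.logb_pow, Real.logb_self_eq_one one_lt_two] at h
    rw [hm]
    push_cast at h
    linarith
  have hgain := sum_condEntropy_le_logb_card_add hA.1 hA.1 hne hne
  have hent := logb_card_eq_sum_condEntropy hA.1 hne
  rw [sum_add_distrib, sum_congr rfl fun i _ => add_self_div_two (condEntropy i A), ← hent,
    ← mul_sum] at hgain
  have hsplit : ∀ f : ℕ → ℝ, ∑ i ∈ range n, f i = ∑ i ∈ range m, f i + ∑ i ∈ Ico m n, f i :=
    fun f => (sum_range_add_sum_Ico f hmn).symm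
  rw [hsplit] at hgain hent
  have h0 := fun i => condEntropy_nonneg i A
  have h1 := fun i => condEntropy_le_one i A
  have hterm : ∀ i, 0 ≤ condEntropy i A * (1 - condEntropy i A)
      + condEntropy i A * (1 - condEntropy i A) := fun i => by nlinarith [h0 i, h1 i]
  have hn1 := sum_nonneg fun i (_ : i ∈ range m) => hterm i
  have hn2 := sum_nonneg fun i (_ : i ∈ Ico m n) => hterm i
  -- With `t = h i`, `2t(1 - t)` dominates `1 - t` when `t ≥ 1/2` and `t` when `t ≤ 1/2`. The first
  -- case bounds the deficit of the head from `m`, hence the tail up to the rounding error `log₂ |A|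
  -- - m ≤ 1`; the second bounds the tail directly.
  rcases le_total (1 / 2) (condEntropy m A) with h | h
  · have : ∑ i ∈ range m, (1 - condEntropy i A) ≤ ∑ i ∈ range m,
        (condEntropy i A * (1 - condEntropy i A) + condEntropy i A * (1 - condEntropy i A)) := by
      refine sum_le_sum fun i hi => ?_
      have : condEntropy m A ≤ condEntropy i A := hA.condEntropy_antitone (mem_range.1 hi).le
      nlinarith [h1 i]
    rw [sum_sub_distrib, sum_const, card_range, nsmul_eq_mul, mul_one] at this
    linarith
  · have : ∑ i ∈ Ico m n, condEntropy i A ≤ ∑ i ∈ Ico m n,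
        (condEntropy i A * (1 - condEntropy i A) + condEntropy i A * (1 - condEntropy i A)) := by
      refine sum_le_sum fun i hi => ?_
      have : condEntropy i A ≤ condEntropy m A := hA.condEntropy_antitone (mem_Ico.1 hi).1
      nlinarith [h0 i]
    linarith

theorem theorem1p8 :
    ∃ C : ℝ, 0 < C ∧ ∀ (n : ℕ) (A : Finset (Fin n → ZMod 2)), A.Nonempty → IsSMD A →
      ∃ T : Finset (Fin n → ZMod 2),
        (#T : ℝ) ≤ C * doublingConst A ^ 30 ∧
        (A : Set (Fin n → ZMod 2)) ⊆
          ⋃ t ∈ T, t +ᵥ (initialSubspace n (Nat.log 2 #A) : Set (Fin n → ZMod 2)) := by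
  refine ⟨2, two_pos, fun n A hne hA => ⟨finalSlice (Nat.log 2 #A) A, ?_,
    hA.1.subset_iUnion_finalSlice _⟩⟩
  set m := Nat.log 2 #A
  have h0 := hA.1.zero_mem hne
  have hT : (0 : ℝ) < #(finalSlice m A) := by
    exact_mod_cast card_pos.2 ⟨0, by simp [finalSlice, h0]⟩
  have hI : (0 : ℝ) < #(initialSlice m A) := by
    exact_mod_cast card_pos.2 ⟨0, hA.1.zero_mem_initialSlice m hne⟩
  have hApos : (0 : ℝ) < #A := by exact_mod_cast hne.card_pos
  have hAApos : (0 : ℝ) < #(A + A) := by exact_mod_cast (hne.add hne).card_pos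
  have hK : 0 < doublingConst A := div_pos hAApos hApos
  have hlogK : Real.logb 2 (doublingConst A) = Real.logb 2 #(A + A) - Real.logb 2 #A :=
    Real.logb_div hAApos.ne' hApos.ne'
  have hmul := logb_natCast_mono (card_finalSlice_mul_card_initialSlice_le m A)
  rw [Nat.cast_mul, Real.logb_mul hT.ne' hI.ne'] at hmul
  have hslice := hA.1.sum_condEntropy_le_logb_card_initialSlice m hne
  have htail := hA.logb_card_sub_sum_le hne
  -- In logarithms, the exponent is `30 = 29 + 1`: `29` from the tail bound and `1` from `|A + A| /
  -- |A|`. The factor `2` absorbs the rounding of `log₂ |A|`.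
  rw [← Real.logb_le_logb one_lt_two hT (by positivity), Real.logb_mul two_ne_zero (by positivity),
    Real.logb_pow, Real.logb_self_eq_one one_lt_two, hlogK]
  push_cast
  linarith
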